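/- Let $V_1$ and $V_2$ be real vector spaces equipped with a bilinear pairing $\langle\,,\,\rangle\colon V_1\times V_2\to\mathbb{R}$, let $S$ be a set, and let $\Pi_1=\{\alpha_s\mid s\in S\}\subseteq V_1$ and $\Pi_2=\{\beta_s\mid s\in S\}\subseteq V_2$ be families indexed bijectively by $S$. For a subset $A$ of a real vector space, let $\mathrm{PLC}(A)$ be the set of all finite linear combinations of elements of $A$ with nonnegative coefficients, at least one of which is positive. Suppose that (D1) $\langle\alpha_s,\beta_s\rangle=1$ for all $s\in S$; (D2) (i) $0\notin\mathrm{PLC}(\Pi_1)$ and $0\notin\mathrm{PLC}(\Pi_2)$; (ii) $\alpha_s\notin\mathrm{PLC}(\Pi_1\setminus\{\alpha_s\})$ and $\beta_s\notin\mathrm{PLC}(\Pi_2\setminus\{\beta_s\})$ for each $s\in S$. For $s\in S$ let $\rho_1(s)\in\mathrm{GL}(V_1)$ and $\rho_2(s)\in\mathrm{GL}(V_2)$ be given by $\rho_1(s)(x)=x-2\langle x,\beta_s\rangle\alpha_s$ and $\rho_2(s)(y)=y-2\langle\alpha_s,y\rangle\beta_s$. For $i\in\{1,2\}$ let $W_i$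 be the subgroup of $\mathrm{GL}(V_i)$ generated by $\{\rho_i(s)\mid s\in S\}$, and put $\Phi_i=W_i\Pi_i$, $\Phi_i^+=\Phi_i\cap\mathrm{PLC}(\Pi_i)$ and $\Phi_i^-=-\Phi_i^+$. Then the following are equivalent: (i) $\Phi_1$ is the disjoint union of $\Phi_1^+$ and $\Phi_1^-$; (ii) $\Phi_2$ is the disjoint union of $\Phi_2^+$ and $\Phi_2^-$; (iii) for all $s,t\in S$ the following three conditions hold: (D3) $\langle\alpha_s,\beta_t\rangle\le 0$ and $\langle\alpha_t,\beta_s\rangle\le 0$ whenever $s\ne t$; (D4) $\langle\alpha_s,\beta_t\rangle=0$ if and only if $\langle\alpha_t,\beta_s\rangle=0$; (D5) either $\langle\alpha_s,\beta_t\rangle\langle\alpha_t,\beta_s\rangle=\cos^2(\pi/m)$ for some integer $m\ge 2$ (depending on $s,t$), or $\langle\alpha_s,\beta_t\rangle\langle\alpha_t,\beta_s\rangle\ge 1$. -/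

import Mathlib

open scoped Pointwise

namespace PairedRoots

/-- The positive linear cone of a subset `A` of a real vector space: all finite linear combinations
of elements of `A` with nonnegative coefficients, at least one of which is positive. -/
def PLC {V : Type*} [AddCommGroup V] [Module ℝ V] (A : Set V) : Set V :=
  {v | ∃ c : V →₀ ℝ, (c.support : Set V) ⊆ A ∧ (∀ a ∈ A, 0 ≤ c a) ∧ (∃ a ∈ A, 0 < c a) ∧
    (c.sum fun a r => r • a) = v}

/-! The constructions below are written for the first space `V` of a pairing `B : V × V' → ℝ`, with
families `α` in `V` and `β` in `V'`.  Those for the second space are obtained by applying them to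
the flipped pairing `B.flip`, with the roles of `α` and `β` exchanged. -/

section

variable {S V V' : Type*} [AddCommGroup V] [Module ℝ V] [AddCommGroup V'] [Module ℝ V']

/-- The reflection `ρ(s) : x ↦ x - 2 ⟨x, β_s⟩ α_s`, as an invertible linear map. -/
noncomputable def rho (B : V →ₗ[ℝ] V' →ₗ[ℝ] ℝ) (α : S → V) (β : S → V')
    (h : ∀ s, B (α s) (β s) = 1) (s : S) : V ≃ₗ[ℝ] V :=
  Module.reflection (x := α s) (f := (2 : ℝ) • B.flip (β s)) (by simp [h s])

theorem rho_apply (B : V →ₗ[ℝ] V' →ₗ[ℝ] ℝ) (α : S → V) (β : S → V')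
    (h : ∀ s, B (α s) (β s) = 1) (s : S) (x : V) :
    rho B α β h s x = x - (2 * B x (β s)) • α s := by
  simp [rho, Module.reflection_apply]

/-- The Weyl group, generated by the reflections `ρ(s)`. -/
def weylGroup (B : V →ₗ[ℝ] V' →ₗ[ℝ] ℝ) (α : S → V) (β : S → V')
    (h : ∀ s, B (α s) (β s) = 1) : Subgroup (V ≃ₗ[ℝ] V) :=
  Subgroup.closure (Set.range (rho B α β h))

/-- The root system `Φ = W Π`, where `Π = {α_s}`. -/
def roots (B : V →ₗ[ℝ] V' →ₗ[ℝ] ℝ) (α : S → V) (β : S → V')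
    (h : ∀ s, B (α s) (β s) = 1) : Set V :=
  {x | ∃ w ∈ weylGroup B α β h, ∃ s : S, w (α s) = x}

/-- The positive roots `Φ⁺ = Φ ∩ PLC(Π)`. -/
def posRoots (B : V →ₗ[ℝ] V' →ₗ[ℝ] ℝ) (α : S → V) (β : S → V')
    (h : ∀ s, B (α s) (β s) = 1) : Set V :=
  roots B α β h ∩ PLC (Set.range α)

/-- The negative roots `Φ⁻ = -Φ⁺`. -/
def negRoots (B : V →ₗ[ℝ] V' →ₗ[ℝ] ℝ) (α : S → V) (β : S → V')
    (h : ∀ s, B (α s) (β s) = 1) : Set V :=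
  -posRoots B α β h

/-- `Φ` is the disjoint union of `Φ⁺` and `Φ⁻`. -/
def RootsDecompose (B : V →ₗ[ℝ] V' →ₗ[ℝ] ℝ) (α : S → V) (β : S → V')
    (h : ∀ s, B (α s) (β s) = 1) : Prop :=
  roots B α β h = posRoots B α β h ∪ negRoots B α β h ∧
    Disjoint (posRoots B α β h) (negRoots B α β h)

end

end PairedRoots

/-! Condition (iii) is symmetric in the two spaces, so it is enough to prove (i) ↔ (iii) and apply
it to `B.flip` as well. The core is a rank two computation: alternating products of the reflections
in `s` and `t` send `α s` to a combination of `α s` and a rescaled `α t` whose coefficients are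
consecutive Chebyshev values `U k` at `x`, where `x ^ 2` is the product of the two pairings
(`alternatingWord_apply`). These are nonnegative if `1 ≤ x`, or if `x = cos (π / m)` and `k < m`; at
any other `x` in `(0, 1)` some root has coefficients of opposite signs, which (D2) forbids.

For (iii) → (i), the reflections satisfy Coxeter relations, so the abstract Coxeter group acts on
`V`. Induction on length, stripping a maximal alternating suffix (`exists_eq_mul_alternatingWord`),
shows that `w` sends `α s` into the cone unless `s` is a right descent of `w`. -/

namespace PairedRoots

/-! ### Positive cones. -/

section PLC

variable {V : Type*} [AddCommGroup V] [Module ℝ V] {A A' : Set V}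

theorem subset_PLC : A ⊆ PLC A := by
  classical
  intro a ha
  refine ⟨Finsupp.single a 1, ?_, fun b _ => ?_, ⟨a, ha, by simp⟩, by simp⟩
  · intro b hb
    have := Finsupp.support_single_subset hb
    simp_all
  · rw [Finsupp.single_apply]; split_ifs <;> norm_num

theorem PLC_mono (h : A ⊆ A') : PLC A ⊆ PLC A' := by
  rintro v ⟨c, hc, h0, ⟨a, ha, hpos⟩, rfl⟩
  refine ⟨c, hc.trans h, fun b _ => ?_, ⟨a, h ha, hpos⟩, rfl⟩
  by_cases hb : b ∈ c.support
  · exact h0 b (hc hb)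
  · rw [Finsupp.notMem_support_iff.mp hb]

theorem add_mem_PLC {v w : V} (hv : v ∈ PLC A) (hw : w ∈ PLC A) : v + w ∈ PLC A := by
  classical
  obtain ⟨c, hc, hc0, ⟨a, ha, hpos⟩, rfl⟩ := hv
  obtain ⟨d, hd, hd0, -, rfl⟩ := hw
  refine ⟨c + d, fun x hx => ?_, fun b hb => add_nonneg (hc0 b hb) (hd0 b hb),
    ⟨a, ha, add_pos_of_pos_of_nonneg hpos (hd0 a ha)⟩, ?_⟩
  · rcases Finset.mem_union.mp (Finsupp.support_add hx) with h | h
    exacts [hc h, hd h]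
  · exact Finsupp.sum_add_index' (by simp) (by intros; rw [add_smul])

theorem smul_mem_PLC {v : V} {r : ℝ} (hr : 0 < r) (hv : v ∈ PLC A) : r • v ∈ PLC A := by
  obtain ⟨c, hc, hc0, ⟨a, ha, hpos⟩, rfl⟩ := hv
  refine ⟨r • c, fun x hx => hc (Finsupp.support_smul hx),
    fun b hb => mul_nonneg hr.le (hc0 b hb), ⟨a, ha, mul_pos hr hpos⟩, ?_⟩
  rw [Finsupp.sum_smul_index' (by simp), Finsupp.smul_sum]
  simp [smul_smul]

/-- A nonnegative, not identically zero combination of two elements of the cone. -/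
theorem smul_add_smul_mem_PLC {v w : V} {c d : ℝ} (hc : 0 ≤ c) (hd : 0 ≤ d) (hcd : 0 < c + d)
    (hv : v ∈ PLC A) (hw : w ∈ PLC A) : c • v + d • w ∈ PLC A := by
  rcases hc.eq_or_lt with rfl | hc
  · simpa using smul_mem_PLC (by simpa using hcd) hw
  rcases hd.eq_or_lt with rfl | hd
  · simpa using smul_mem_PLC hc hv
  exact add_mem_PLC (smul_mem_PLC hc hv) (smul_mem_PLC hd hw)

/-- Isolating the coefficient of one generator. -/
theorem exists_eq_smul_add_of_mem_PLC {v a : V} (ha : a ∈ A) (hv : v ∈ PLC A) :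
    ∃ r : ℝ, 0 ≤ r ∧ ∃ w, (w = 0 ∨ w ∈ PLC (A \ {a})) ∧ v = r • a + w := by
  classical
  obtain ⟨c, hc, hc0, -, rfl⟩ := hv
  refine ⟨c a, hc0 a ha, (c.erase a).sum fun b r => r • b, ?_, ?_⟩
  · by_cases h : c.erase a = 0
    · left; simp [h]
    · right
      have hsub : ((c.erase a).support : Set V) ⊆ A \ {a} := by
        intro x hx
        simp only [Finsupp.support_erase, Finset.coe_erase] at hx
        exact ⟨hc hx.1, hx.2⟩
      obtain ⟨b, hb⟩ := Finsupp.support_nonempty_iff.mpr h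
      have hbA := hsub hb
      have hnn : ∀ x ∈ A \ {a}, 0 ≤ c.erase a x := fun x hx => by
        rw [Finsupp.erase_ne hx.2]; exact hc0 x hx.1
      exact ⟨_, hsub, hnn, ⟨b, hbA, (hnn b hbA).lt_of_ne' (Finsupp.mem_support_iff.mp hb)⟩, rfl⟩
  · exact (Finsupp.add_sum_erase' c a (fun b r => r • b) (by simp)).symm

/-- If `r` is the coefficient of `a` in such a combination, then `(x - r) • a` lies in the cone of
the other generators. For `r < x` this puts `a` in that cone; for `x ≤ r` it puts `0` in the cone of
`A`. -/
theorem smul_sub_smul_notMem_PLC {a b : V} (h0 : (0 : V) ∉ PLC A) (ha : a ∈ A) (hb : b ∈ A)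
    (hab : a ≠ b) (haA : a ∉ PLC (A \ {a})) {x y : ℝ} (hy : 0 < y) :
    x • a - y • b ∉ PLC A := by
  intro h
  obtain ⟨r, hr, w, hw, e⟩ := exists_eq_smul_add_of_mem_PLC ha h
  have hz : y • b + w ∈ PLC (A \ {a}) := by
    have hb' : y • b ∈ PLC (A \ {a}) := smul_mem_PLC hy (subset_PLC ⟨hb, hab.symm⟩)
    rcases hw with rfl | hw
    · simpa using hb'
    · exact add_mem_PLC hb' hw
  have e' : y • b + w = (x - r) • a := by
    rw [sub_smul]; rw [sub_eq_iff_eq_add] at e; rw [e]; abel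
  rcases lt_or_ge r x with hx | hx
  · apply haA
    have := smul_mem_PLC (inv_pos.mpr (sub_pos.mpr hx)) hz
    rwa [e', inv_smul_smul₀ (sub_pos.mpr hx).ne'] at this
  · apply h0
    have hz' := PLC_mono Set.sdiff_subset hz
    rcases hx.eq_or_lt with rfl | hx
    · simpa [e'] using hz'
    · have := add_mem_PLC hz' (smul_mem_PLC (sub_pos.mpr hx) (subset_PLC ha))
      rwa [e', ← add_smul, sub_add_sub_cancel, sub_self, zero_smul] at this

end PLC

/-! ### Signs of Chebyshev polynomials of the second kind. -/

section Chebyshev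

open Polynomial Polynomial.Chebyshev Real

theorem eval_U_add_one (x : ℝ) (k : ℤ) :
    (U ℝ (k + 1)).eval x = 2 * x * (U ℝ k).eval x - (U ℝ (k - 1)).eval x := by
  have := congrArg (eval x) (U_add_two ℝ (k - 1))
  rw [show k - 1 + 2 = k + 1 by ring, show k - 1 + 1 = k by ring] at this
  simpa using this

theorem one_le_eval_U {x : ℝ} (hx : 1 ≤ x) (k : ℕ) :
    1 ≤ (U ℝ k).eval x ∧ (U ℝ ((k : ℤ) - 1)).eval x ≤ (U ℝ k).eval x := by
  induction k with
  | zero => simp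
  | succ k ih =>
    push_cast
    rw [eval_U_add_one, add_sub_cancel_right]
    constructor <;> nlinarith [ih.1, ih.2]

/-- With `θ = π / m`, the values are `sin ((k + 1) θ) / sin θ` and `sin (k θ) / sin θ`, and both
angles lie in `[0, π]`. -/
theorem eval_U_cos_nonneg {m k : ℕ} (hm : 2 ≤ m) (hk : k < m) :
    0 ≤ (U ℝ k).eval (cos (π / m)) ∧ 0 ≤ (U ℝ ((k : ℤ) - 1)).eval (cos (π / m)) ∧
      0 < (U ℝ k).eval (cos (π / m)) + (U ℝ ((k : ℤ) - 1)).eval (cos (π / m)) := by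
  have hm0 : (0 : ℝ) < m := by positivity
  have hm2 : (2 : ℝ) ≤ m := by exact_mod_cast hm
  have hsin : 0 < sin (π / m) := by
    apply sin_pos_of_pos_of_lt_pi (by positivity)
    rw [div_lt_iff₀ hm0]; nlinarith [pi_pos]
  have h1 := U_real_cos (π / m) k
  have h2 := U_real_cos (π / m) ((k : ℤ) - 1)
  push_cast at h1 h2
  rw [sub_add_cancel] at h2
  have hk' : (k : ℝ) + 1 ≤ m := by exact_mod_cast hk
  have e1 : 0 ≤ sin (((k : ℝ) + 1) * (π / m)) := by
    apply sin_nonneg_of_nonneg_of_le_pi (by positivity)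
    rw [← mul_div_assoc, div_le_iff₀ hm0]; nlinarith [pi_pos]
  have p1 : 0 ≤ (U ℝ k).eval (cos (π / m)) :=
    nonneg_of_mul_nonneg_left (h1 ▸ e1) hsin
  rcases Nat.eq_zero_or_pos k with rfl | hkpos
  · simp
  have e2 : 0 < sin ((k : ℝ) * (π / m)) := by
    apply sin_pos_of_pos_of_lt_pi (by positivity)
    rw [← mul_div_assoc, div_lt_iff₀ hm0]; nlinarith [pi_pos]
  have p2 : 0 < (U ℝ ((k : ℤ) - 1)).eval (cos (π / m)) :=
    pos_of_mul_pos_left (h2 ▸ e2) hsin.le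
  exact ⟨p1, p2.le, by linarith⟩

/-- If consecutive values of the Chebyshev polynomials of the second kind at a point of `(0, 1)`
never have opposite signs, then that point is `cos (π / m)`. -/
theorem exists_eq_cos_of_eval_U {x : ℝ} (hx0 : 0 < x) (hx1 : x < 1)
    (h : ∀ k : ℕ, ¬ (0 < (U ℝ k).eval x ∧ (U ℝ ((k : ℤ) + 1)).eval x < 0)) :
    ∃ m : ℕ, 2 ≤ m ∧ x = cos (π / m) := by
  set θ := arccos x with hθ
  have hcos : cos θ = x := cos_arccos (by linarith) hx1.le
  have hθ0 : 0 < θ := arccos_pos.mpr hx1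
  have hθ1 : θ < π / 2 := arccos_lt_pi_div_two.mpr hx0
  have hsin : 0 < sin θ := sin_pos_of_pos_of_lt_pi hθ0 (by linarith [pi_pos])
  -- Either `(N + 1) θ = π`, giving `m = N + 1`, or the sine changes sign strictly between `N θ` and
  -- `(N + 1) θ`, contradicting `h` at `N - 1`.
  obtain ⟨N, hN1, hN2⟩ : ∃ N : ℕ, N * θ < π ∧ π ≤ (N + 1) * θ := by
    have hex : ∃ n : ℕ, π ≤ n * θ := by
      obtain ⟨n, hn⟩ := exists_nat_ge (π / θ)
      exact ⟨n, (div_le_iff₀ hθ0).mp hn⟩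
    classical
    have hs := Nat.find_spec hex
    have hpos : Nat.find hex ≠ 0 := fun h0 => by
      rw [h0] at hs; simp at hs; linarith [pi_pos]
    obtain ⟨N, hN⟩ := Nat.exists_eq_succ_of_ne_zero hpos
    refine ⟨N, not_le.mp (Nat.find_min hex (by omega)), ?_⟩
    rw [hN] at hs; exact_mod_cast hs
  have hNpos : 0 < N := by
    rcases Nat.eq_zero_or_pos N with rfl | h'
    · norm_num at hN2; linarith [pi_pos]
    · exact h'
  obtain ⟨k, rfl⟩ := Nat.exists_eq_succ_of_ne_zero hNpos.ne'
  push_cast at hN1 hN2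
  rcases hN2.eq_or_lt with e | hlt
  · refine ⟨k + 2, by omega, ?_⟩
    rw [← hcos]; congr 1
    push_cast
    rw [eq_div_iff (by positivity)]; linarith
  · exfalso
    apply h k
    have h1 := U_real_cos θ k
    have h2 := U_real_cos θ ((k : ℤ) + 1)
    rw [hcos] at h1 h2
    push_cast at h1 h2
    have s1 : 0 < sin (((k : ℝ) + 1) * θ) := sin_pos_of_pos_of_lt_pi (by positivity) hN1
    have s2 : sin (((k : ℝ) + 1 + 1) * θ) < 0 := by
      have : 0 < sin (((k : ℝ) + 1 + 1) * θ - π) :=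
        sin_pos_of_pos_of_lt_pi (by linarith) (by linarith)
      rw [sin_sub_pi] at this; linarith
    exact ⟨pos_of_mul_pos_left (h1 ▸ s1) hsin.le, neg_of_mul_neg_left (h2 ▸ s2) hsin.le⟩

end Chebyshev

/-! ### Two reflections: alternating products and their order. -/

section Pairing

variable {S V V' : Type*} [AddCommGroup V] [Module ℝ V] [AddCommGroup V'] [Module ℝ V']
  (B : V →ₗ[ℝ] V' →ₗ[ℝ] ℝ) (α : S → V) (β : S → V') (h : ∀ s, B (α s) (β s) = 1)

open Polynomial Polynomial.Chebyshev CoxeterSystem Real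

/-- Replacing `α t` by `l • α t` and `β t` by `l⁻¹ • β t` makes both pairings equal to `-x`, with `x
= √(a * b)`. -/
theorem exists_scaling {a b : ℝ} (ha : a ≤ 0) (hb : b ≤ 0) (hab : a = 0 ↔ b = 0) :
    ∃ x l : ℝ, 0 ≤ x ∧ 0 < l ∧ a = -(x * l) ∧ b * l = -x := by
  rcases ha.eq_or_lt with rfl | ha'
  · exact ⟨0, 1, le_rfl, one_pos, by simp, by simp [hab.mp rfl]⟩
  have hb' : b < 0 := hb.lt_of_ne fun e => ha'.ne (hab.mpr e)
  have hpos : 0 < a * b := mul_pos_of_neg_of_neg ha' hb'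
  have hx : 0 < √(a * b) := sqrt_pos.mpr hpos
  refine ⟨√(a * b), -a / √(a * b), hx.le, div_pos (by linarith) hx, by field_simp, ?_⟩
  rw [mul_div_assoc', div_eq_iff hx.ne', neg_mul, mul_self_sqrt hpos.le]; ring

/-- In the basis `α s`, `l • α t`, each new reflection changes one coefficient, exactly by the
recursion `U (k + 1) = 2 x U k - U (k - 1)`. -/
theorem alternatingWord_apply {s t : S} {x l : ℝ} (hst : B (α s) (β t) = -(x * l))
    (hts : B (α t) (β s) * l = -x) (k : ℕ) :
    ((alternatingWord s t k).map (rho B α β h)).prod (α s) =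
      if Even k then (U ℝ k).eval x • α s + (l * (U ℝ ((k : ℤ) - 1)).eval x) • α t
      else (U ℝ ((k : ℤ) - 1)).eval x • α s + (l * (U ℝ k).eval x) • α t := by
  induction k with
  | zero => simp [alternatingWord]
  | succ k ih =>
    rw [alternatingWord_succ', List.map_cons, List.prod_cons, LinearEquiv.mul_apply, ih]
    push_cast
    rw [eval_U_add_one, add_sub_cancel_right]
    by_cases hk : Even k
    · simp only [hk, if_true, Nat.even_add_one, not_true_eq_false, if_false, rho_apply, map_add,
        map_smul, h, hst]
      module
    · simp only [hk, if_false, Nat.even_add_one, not_false_eq_true, if_true, rho_apply, map_add,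
        map_smul, h]
      match_scalars
      · linear_combination (-2 * (U ℝ k).eval x) * hts
      · ring

theorem rho_mul_rho_pow {s t : S} {m : ℕ} (hm : 2 ≤ m)
    (h0 : B (α s) (β t) = 0 ↔ B (α t) (β s) = 0)
    (hst : B (α s) (β t) * B (α t) (β s) = cos (π / m) ^ 2) :
    (rho B α β h s * rho B α β h t) ^ m = 1 := by
  -- For `m = 2` the formula below would divide by `sin π = 0`; here both pairings vanish and the
  -- reflections commute.
  rcases hm.eq_or_lt with rfl | hm
  · have e : B (α s) (β t) = 0 ∧ B (α t) (β s) = 0 := by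
      have : B (α s) (β t) * B (α t) (β s) = 0 := by simp [hst]
      rcases mul_eq_zero.mp this with e | e
      exacts [⟨e, h0.mp e⟩, ⟨h0.mpr e, e⟩]
    ext z
    simp only [pow_two, LinearEquiv.mul_apply, rho_apply, map_sub, map_smul,
      e.1, e.2, h, LinearEquiv.coe_one, id]
    module
  have hm0 : (0 : ℝ) < m := by positivity
  have hm2 : (2 : ℝ) < m := by exact_mod_cast hm
  have hsin : sin (2 * (π / m)) ≠ 0 := by
    refine (sin_pos_of_pos_of_lt_pi (by positivity) ?_).ne'
    rw [← mul_div_assoc, div_lt_iff₀ hm0]; nlinarith [pi_pos]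
  have key : ∀ n : ℤ, (Chebyshev.S ℝ n).eval (2 * cos (2 * (π / m))) =
      sin ((n + 1) * (2 * (π / m))) / sin (2 * (π / m)) := fun n => by
    rw [eq_div_iff hsin]; exact S_two_mul_real_cos _ n
  ext z
  have ht : 2 * cos (2 * (π / m)) =
      ((2 : ℝ) • B.flip (β s)) (α t) * ((2 : ℝ) • B.flip (β t)) (α s) - 2 := by
    simp only [LinearMap.smul_apply, LinearMap.flip_apply, smul_eq_mul]
    rw [cos_two_mul]
    linear_combination -4 * hst
  have := Module.reflection_mul_reflection_pow_apply (x := α s) (y := α t)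
    (f := (2 : ℝ) • B.flip (β s)) (g := (2 : ℝ) • B.flip (β t)) (by simp [h]) (by simp [h]) m z
    (2 * cos (2 * (π / m))) ht
  refine this.trans ?_
  -- The correction terms to the identity carry a factor that vanishes: `S (j - 1)` for `m = 2 j`,
  -- and `S j + S (j - 1)` for `m = 2 j + 1`.
  rcases Nat.even_or_odd' m with ⟨j, rfl | rfl⟩
  · have hj : (Chebyshev.S ℝ ((j : ℤ) - 1)).eval (2 * cos (2 * (π / (2 * j : ℕ)))) = 0 := by
      rw [key]
      have hj0 : (j : ℝ) ≠ 0 := by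
        rintro e
        simp [e] at hm0
      push_cast
      rw [sub_add_cancel, show (j : ℝ) * (2 * (π / (2 * j))) = π by field_simp]
      simp
    rw [show (((2 * j : ℕ) : ℤ) - 2) / 2 = j - 1 by omega,
      show (((2 * j : ℕ) : ℤ) - 1) / 2 = j - 1 by omega, hj]
    simp
  · have hj : (Chebyshev.S ℝ (j : ℤ)).eval (2 * cos (2 * (π / (2 * j + 1 : ℕ)))) +
        (Chebyshev.S ℝ ((j : ℤ) - 1)).eval (2 * cos (2 * (π / (2 * j + 1 : ℕ)))) = 0 := by
      rw [key, key, ← add_div]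
      push_cast at hm0 ⊢
      rw [show ((j : ℝ) + 1) * (2 * (π / (2 * j + 1))) =
        2 * π - ((j : ℝ) - 1 + 1) * (2 * (π / (2 * j + 1))) by field_simp; ring, sin_two_pi_sub]
      simp
    rw [show (((2 * j + 1 : ℕ) : ℤ) - 2) / 2 = j - 1 by omega,
      show (((2 * j + 1 : ℕ) : ℤ) - 1) / 2 = j by omega,
      show (((2 * j + 1 : ℕ) : ℤ) - 3) / 2 = j - 1 by omega,
      show (((2 * j + 1 : ℕ) : ℤ)) / 2 = j by omega, hj]
    simp

end Pairing

/-! ### Alternating suffixes in a Coxeter group. -/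

section Coxeter

variable {S W : Type*} [Group W] {M : CoxeterMatrix S} (cs : CoxeterSystem M W)

open CoxeterSystem

/-- If `s` is not a right descent of `w` and `t` is, then `w` factors as a product `v * u`, where
neither `s` nor `t` is a right descent of `v`, and `u` is an alternating word in `s` and `t` of
length less than `M s t` (when this is not infinite). -/
theorem exists_eq_mul_alternatingWord {w : W} {s t : S} (hs : ¬ cs.IsRightDescent w s)
    (ht : cs.IsRightDescent w t) :
    ∃ (v : W) (k : ℕ), w = v * cs.wordProd (alternatingWord s t k) ∧ cs.length v < cs.length w ∧
      ¬ cs.IsRightDescent v s ∧ ¬ cs.IsRightDescent v t ∧ (M s t ≠ 0 → k < M s t) := by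
  classical
  let P : ℕ → Prop := fun k =>
    ∃ v : W, w = v * cs.wordProd (alternatingWord s t k) ∧ cs.length v + k = cs.length w
  have hP1 : P 1 := ⟨w * cs.simple t, by simp [alternatingWord], cs.isRightDescent_iff.mp ht⟩
  have hbound : ∀ k, P k → k ≤ cs.length w := by rintro k ⟨v, -, hv⟩; omega
  have hw1 : 1 ≤ cs.length w := hbound 1 hP1
  have hPk : P (Nat.findGreatest P (cs.length w)) := Nat.findGreatest_spec hw1 hP1
  have hk1 : 1 ≤ Nat.findGreatest P (cs.length w) := Nat.le_findGreatest hw1 hP1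
  have hmax : ¬ P (Nat.findGreatest P (cs.length w) + 1) := fun hp => by
    have := Nat.le_findGreatest (hbound _ hp) hp
    omega
  generalize Nat.findGreatest P (cs.length w) = k at hPk hk1 hmax
  obtain ⟨v, hv, hlen⟩ := hPk
  obtain ⟨j, rfl⟩ := Nat.exists_eq_succ_of_ne_zero (Nat.one_le_iff_ne_zero.mp hk1)
  -- This is the first letter of the suffix; were it a descent of `v`, cancelling it would make `w`
  -- too short. The other letter, in `hsecond`, would lengthen the maximal suffix.
  have hfirst : ¬ cs.IsRightDescent v (if Even j then t else s) := fun hd => by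
    have h1 := cs.isRightDescent_iff.mp hd
    have h2 : w = (v * cs.simple (if Even j then t else s)) *
        cs.wordProd (alternatingWord s t j) := by
      rw [hv, Nat.succ_eq_add_one, alternatingWord_succ', wordProd_cons, mul_assoc]
    have h3 := cs.length_mul_le (v * cs.simple (if Even j then t else s))
      (cs.wordProd (alternatingWord s t j))
    have h4 := cs.length_wordProd_le (alternatingWord s t j)
    rw [← h2] at h3
    rw [length_alternatingWord] at h4
    omega
  have hsecond : ¬ cs.IsRightDescent v (if Even (j + 1) then t else s) := fun hd => by
    have h1 := cs.isRightDescent_iff.mp hd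
    refine hmax ⟨v * cs.simple (if Even (j + 1) then t else s), ?_, by omega⟩
    rw [hv, alternatingWord_succ' s t (j + 1), wordProd_cons, mul_assoc,
      simple_mul_simple_cancel_left]
  refine ⟨v, j + 1, hv, by omega, ?_, ?_, fun hM => ?_⟩
  · by_cases hj : Even j
    · simpa [Nat.even_add_one, hj] using hsecond
    · simpa [hj] using hfirst
  · by_cases hj : Even j
    · simpa [hj] using hfirst
    · simpa [Nat.even_add_one, hj] using hsecond
  -- A suffix of length at least `M s t` ends in a braid word, which can be rewritten to end in `s`,
  -- making `s` a descent of `w`.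
  · by_contra! hle
    have hsplit : ∀ n : ℕ, ∃ u : W, cs.length u ≤ n ∧ cs.wordProd (alternatingWord s t (M s t + n))
        = u * cs.wordProd (alternatingWord s t (M s t)) := by
      intro n
      induction n with
      | zero => exact ⟨1, by simp, by simp⟩
      | succ n ih =>
        obtain ⟨u, hu, e⟩ := ih
        refine ⟨cs.simple (if Even (M s t + n) then t else s) * u, ?_, ?_⟩
        · have := cs.length_mul_le (cs.simple (if Even (M s t + n) then t else s)) u
          rw [length_simple] at this
          omega
        · rw [← add_assoc, alternatingWord_succ', wordProd_cons, e, mul_assoc]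
    obtain ⟨n, hn⟩ := Nat.exists_eq_add_of_le hle
    obtain ⟨u, hu, e⟩ := hsplit n
    obtain ⟨p, hp⟩ := Nat.exists_eq_succ_of_ne_zero hM
    have hbraid : cs.wordProd (alternatingWord s t (M s t)) =
        cs.wordProd (alternatingWord s t p) * cs.simple s := by
      have := cs.wordProd_braidWord_eq s t
      simp only [braidWord] at this
      rw [this, M.symmetric t s, hp, Nat.succ_eq_add_one, alternatingWord_succ, wordProd_concat]
    have hws : w * cs.simple s = v * u * cs.wordProd (alternatingWord s t p) := by
      rw [hv, Nat.succ_eq_add_one, hn, e, hbraid]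
      simp [mul_assoc]
    have h1 := cs.length_mul_le (v * u) (cs.wordProd (alternatingWord s t p))
    have h2 := cs.length_mul_le v u
    have h3 := cs.length_wordProd_le (alternatingWord s t p)
    have h4 := cs.not_isRightDescent_iff.mp hs
    rw [← hws] at h1
    rw [length_alternatingWord] at h3
    omega

end Coxeter

/-! ### The equivalence for one side of the pairing. -/

section Decompose

variable {S V V' : Type*} [AddCommGroup V] [Module ℝ V] [AddCommGroup V'] [Module ℝ V']
  (B : V →ₗ[ℝ] V' →ₗ[ℝ] ℝ) (α : S → V) (β : S → V') (h : ∀ s, B (α s) (β s) = 1)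

open Polynomial Polynomial.Chebyshev CoxeterSystem Real

/-- The conditions on the pairing of two members of the bases that characterize the decomposition
of the root system into positive and negative roots. -/
def IsCoxeterPair (s t : S) : Prop :=
  (s ≠ t → B (α s) (β t) ≤ 0 ∧ B (α t) (β s) ≤ 0) ∧
    (B (α s) (β t) = 0 ↔ B (α t) (β s) = 0) ∧
    ((∃ m : ℕ, 2 ≤ m ∧ B (α s) (β t) * B (α t) (β s) = Real.cos (Real.pi / m) ^ 2) ∨
      1 ≤ B (α s) (β t) * B (α t) (β s))

variable {B α β}

theorem exists_coxeterMatrix (hC : ∀ s t, IsCoxeterPair B α β s t) :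
    ∃ M : CoxeterMatrix S, ∀ s t, s ≠ t →
      (2 ≤ M s t ∧ B (α s) (β t) * B (α t) (β s) = cos (π / M s t) ^ 2) ∨
      (M s t = 0 ∧ 1 ≤ B (α s) (β t) * B (α t) (β s)) := by
  classical
  let f : ℝ → ℕ := fun r =>
    -- The entry `0` encodes infinite order. As `f` sees only the product of the pairings, the
    -- matrix is symmetric.
    if hr : ∃ m : ℕ, 2 ≤ m ∧ r = cos (π / m) ^ 2 then hr.choose else 0
  have hf : ∀ r, (2 ≤ f r ∧ r = cos (π / f r) ^ 2) ∨
      (f r = 0 ∧ ¬ ∃ m : ℕ, 2 ≤ m ∧ r = cos (π / m) ^ 2) := by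
    intro r
    by_cases hr : ∃ m : ℕ, 2 ≤ m ∧ r = cos (π / m) ^ 2
    · left
      simp only [f, dif_pos hr]
      exact hr.choose_spec
    · exact .inr ⟨by simp only [f, dif_neg hr], hr⟩
  refine ⟨{ M := Matrix.of fun s t => if s = t then 1 else f (B (α s) (β t) * B (α t) (β s)),
            isSymm := ?_, diagonal := by simp, off_diagonal := ?_ }, ?_⟩
  · ext s t
    simp [eq_comm, mul_comm]
  · intro s t hst
    simp only [Matrix.of_apply, if_neg hst]
    rcases hf (B (α s) (β t) * B (α t) (β s)) with h | h <;> omega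
  · intro s t hst
    simp only [Matrix.of_apply, if_neg hst]
    rcases hf (B (α s) (β t) * B (α t) (β s)) with h | h
    · exact .inl h
    · exact .inr ⟨h.1, (hC s t).2.2.resolve_left h.2⟩

/-- Alternating words of length less than the order send `α s` to a nonnegative combination of
`α s` and `α t`. -/
theorem exists_alternatingWord_apply_eq {s t : S} (hst : s ≠ t) (hC : IsCoxeterPair B α β s t)
    {m k : ℕ} (hm : (2 ≤ m ∧ B (α s) (β t) * B (α t) (β s) = cos (π / m) ^ 2) ∨
      (m = 0 ∧ 1 ≤ B (α s) (β t) * B (α t) (β s))) (hk : m ≠ 0 → k < m) :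
    ∃ c d : ℝ, 0 ≤ c ∧ 0 ≤ d ∧ 0 < c + d ∧
      ((alternatingWord s t k).map (rho B α β h)).prod (α s) = c • α s + d • α t := by
  obtain ⟨x, l, hx, hl, ha, hb⟩ := exists_scaling (hC.1 hst).1 (hC.1 hst).2 hC.2.1
  have hab : B (α s) (β t) * B (α t) (β s) = x ^ 2 := by
    rw [ha]; linear_combination (-x) * hb
  rw [alternatingWord_apply B α β h ha hb]
  have hU : 0 ≤ (U ℝ k).eval x ∧ 0 ≤ (U ℝ ((k : ℤ) - 1)).eval x ∧
      0 < (U ℝ k).eval x + (U ℝ ((k : ℤ) - 1)).eval x := by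
    rcases hm with ⟨hm, e⟩ | ⟨rfl, e⟩
    · have hm2 : (2 : ℝ) ≤ m := by exact_mod_cast hm
      have hcos : 0 ≤ cos (π / m) := by
        apply cos_nonneg_of_neg_pi_div_two_le_of_le
        · have : 0 ≤ π / m := by positivity
          linarith [pi_pos]
        · exact div_le_div_of_nonneg_left pi_pos.le two_pos hm2
      have hxe : x = cos (π / m) := (sq_eq_sq₀ hx hcos).mp (hab.symm.trans e)
      rw [hxe]
      exact eval_U_cos_nonneg hm (hk (by omega))
    · have hx1 : 1 ≤ x := by rw [hab] at e; nlinarith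
      rcases Nat.eq_zero_or_pos k with rfl | hkpos
      · simp
      obtain ⟨j, rfl⟩ := Nat.exists_eq_succ_of_ne_zero hkpos.ne'
      have h1 := (one_le_eval_U hx1 (j + 1)).1
      have h2 := (one_le_eval_U hx1 j).1
      push_cast at h1 ⊢
      rw [add_sub_cancel_right]
      exact ⟨by linarith, by linarith, by linarith⟩
  obtain ⟨h1, h2, h3⟩ := hU
  have hsum : ∀ {p q : ℝ}, 0 ≤ p → 0 ≤ q → 0 < p + q → 0 < p + l * q := by
    intro p q hp hq hpq
    rcases hq.eq_or_lt with rfl | hq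
    · simpa using hpq
    · have := mul_pos hl hq
      linarith
  split_ifs
  · exact ⟨_, _, h1, mul_nonneg hl.le h2, hsum h1 h2 h3, rfl⟩
  · exact ⟨_, _, h2, mul_nonneg hl.le h1, hsum h2 h1 (by linarith), rfl⟩

theorem rho_mul_self (s : S) : rho B α β h s * rho B α β h s = 1 := by
  ext z
  simp only [LinearEquiv.mul_apply, rho_apply, map_sub, map_smul, h,
    LinearEquiv.coe_one, id]
  module

theorem rho_apply_self (s : S) : rho B α β h s (α s) = -α s := by
  rw [rho_apply, h]; module

theorem rho_mem_weylGroup (s : S) : rho B α β h s ∈ weylGroup B α β h :=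
  Subgroup.subset_closure ⟨s, rfl⟩

theorem neg_mem_roots {x : V} (hx : x ∈ roots B α β h) : -x ∈ roots B α β h := by
  obtain ⟨w, hw, s, rfl⟩ := hx
  refine ⟨w * rho B α β h s, mul_mem hw (rho_mem_weylGroup h s), s, ?_⟩
  rw [LinearEquiv.mul_apply, rho_apply_self, map_neg]

/-- A root is positive when `s` is not a right descent of the corresponding group element. -/
theorem apply_mem_PLC_of_not_isRightDescent (hC : ∀ s t, IsCoxeterPair B α β s t)
    {M : CoxeterMatrix S} (hM : ∀ s t, s ≠ t →
      (2 ≤ M s t ∧ B (α s) (β t) * B (α t) (β s) = cos (π / M s t) ^ 2) ∨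
      (M s t = 0 ∧ 1 ≤ B (α s) (β t) * B (α t) (β s)))
    {W : Type*} [Group W] (cs : CoxeterSystem M W) (φ : W →* (V ≃ₗ[ℝ] V))
    (hφ : ∀ s, φ (cs.simple s) = rho B α β h s) {w : W} {s : S}
    (hs : ¬ cs.IsRightDescent w s) : φ w (α s) ∈ PLC (Set.range α) := by
  induction hn : cs.length w using Nat.strong_induction_on generalizing w s with
  | _ n ih =>
    by_cases hw : w = 1
    · subst hw
      simpa using subset_PLC (Set.mem_range_self s)
    obtain ⟨t, ht⟩ := cs.exists_rightDescent_of_ne_one hw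
    have hst : s ≠ t := by rintro rfl; exact hs ht
    obtain ⟨v, k, e, hlen, hvs, hvt, hk⟩ := exists_eq_mul_alternatingWord cs hs ht
    obtain ⟨c, d, hc, hd, hcd, e'⟩ :=
      exists_alternatingWord_apply_eq h hst (hC s t) (hM s t hst) hk
    have hφw : φ (cs.wordProd (alternatingWord s t k)) =
        ((alternatingWord s t k).map (rho B α β h)).prod := by
      simp only [wordProd, map_list_prod, List.map_map]
      congr 2
      ext1 i
      exact hφ i
    rw [e, map_mul, LinearEquiv.mul_apply, hφw, e', map_add, map_smul, map_smul]
    exact smul_add_smul_mem_PLC hc hd hcd (ih _ (hn ▸ hlen) hvs rfl) (ih _ (hn ▸ hlen) hvt rfl)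

/-- Only surjectivity of the Coxeter group onto the Weyl group is needed, not faithfulness. -/
theorem rootsDecompose_of_isCoxeterPair (h0 : (0 : V) ∉ PLC (Set.range α))
    (hC : ∀ s t, IsCoxeterPair B α β s t) : RootsDecompose B α β h := by
  obtain ⟨M, hM⟩ := exists_coxeterMatrix hC
  let cs := M.toCoxeterSystem
  have hlift : M.IsLiftable (rho B α β h) := by
    intro s t
    by_cases hst : s = t
    · subst hst
      rw [rho_mul_self, one_pow]
    rcases hM s t hst with ⟨hm, e⟩ | ⟨hm, -⟩
    · exact rho_mul_rho_pow B α β h hm (hC s t).2.1 e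
    · rw [hm, pow_zero]
  let φ : M.Group →* (V ≃ₗ[ℝ] V) := cs.lift ⟨_, hlift⟩
  have hφ : ∀ s, φ (cs.simple s) = rho B α β h s := cs.lift_apply_simple hlift
  have hsurj : ∀ w ∈ weylGroup B α β h, ∃ u, φ u = w := by
    intro w hw
    have : weylGroup B α β h ≤ φ.range := by
      rw [weylGroup, Subgroup.closure_le]
      rintro _ ⟨s, rfl⟩
      exact ⟨cs.simple s, hφ s⟩
    exact this hw
  refine ⟨Set.Subset.antisymm ?_ ?_, ?_⟩
  · rintro x ⟨w, hw, s, rfl⟩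
    have hx : w (α s) ∈ roots B α β h := ⟨w, hw, s, rfl⟩
    obtain ⟨u, rfl⟩ := hsurj w hw
    by_cases hu : cs.IsRightDescent u s
    · right
      have := apply_mem_PLC_of_not_isRightDescent h hC hM cs φ hφ
        (cs.isRightDescent_iff_not_isRightDescent_mul.mp hu)
      rw [map_mul, LinearEquiv.mul_apply, hφ, rho_apply_self, map_neg] at this
      exact ⟨neg_mem_roots h hx, this⟩
    · exact .inl ⟨hx, apply_mem_PLC_of_not_isRightDescent h hC hM cs φ hφ hu⟩
  · rintro x (hx | hx)
    · exact hx.1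
    · simpa using neg_mem_roots h hx.1
  · rw [Set.disjoint_left]
    rintro x hx hx'
    apply h0
    simpa using add_mem_PLC hx.2 hx'.2

theorem smul_sub_smul_notMem_roots (hα : Function.Injective α)
    (h0 : (0 : V) ∉ PLC (Set.range α)) (hirr : ∀ s, α s ∉ PLC (Set.range α \ {α s}))
    (hdec : RootsDecompose B α β h) {s t : S} (hst : s ≠ t) {x y : ℝ} (hx : 0 < x) (hy : 0 < y) :
    x • α s - y • α t ∉ roots B α β h := by
  intro hmem
  rw [hdec.1] at hmem
  rcases hmem with hm | hm
  · exact smul_sub_smul_notMem_PLC h0 ⟨s, rfl⟩ ⟨t, rfl⟩ (hα.ne hst) (hirr s) hy hm.2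
  · have := hm.2
    rw [neg_sub] at this
    exact smul_sub_smul_notMem_PLC h0 ⟨t, rfl⟩ ⟨s, rfl⟩ (hα.ne hst.symm) (hirr t) hx this

/-- Each violated condition produces a forbidden root of mixed signs: `rho t` applied to `α s`, `rho
t * rho s` applied to `α t`, or a longer alternating word applied to `α s`. -/
theorem isCoxeterPair_of_rootsDecompose (hα : Function.Injective α)
    (h0 : (0 : V) ∉ PLC (Set.range α)) (hirr : ∀ s, α s ∉ PLC (Set.range α \ {α s}))
    (hdec : RootsDecompose B α β h) (s t : S) : IsCoxeterPair B α β s t := by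
  by_cases hst : s = t
  · subst hst
    exact ⟨fun hne => (hne rfl).elim, Iff.rfl, .inr (by simp [h])⟩
  have hno : ∀ {s t : S}, s ≠ t → ∀ {x y : ℝ}, 0 < x → 0 < y →
      x • α s - y • α t ∉ roots B α β h := fun hst _ _ hx hy =>
    smul_sub_smul_notMem_roots h hα h0 hirr hdec hst hx hy
  have hle : ∀ {s t : S}, s ≠ t → B (α s) (β t) ≤ 0 := by
    intro s t hst
    by_contra! hpos
    refine hno hst one_pos (mul_pos two_pos hpos) ⟨_, rho_mem_weylGroup h t, s, ?_⟩
    rw [rho_apply, one_smul]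
  have hzero : ∀ {s t : S}, s ≠ t → B (α s) (β t) = 0 → B (α t) (β s) = 0 := by
    intro s t hst hz
    by_contra hne
    have hneg : B (α t) (β s) < 0 := (hle (Ne.symm hst)).lt_of_ne hne
    refine hno hst (x := -(2 * B (α t) (β s))) (by linarith) one_pos
      ⟨_, mul_mem (rho_mem_weylGroup h t) (rho_mem_weylGroup h s), t, ?_⟩
    rw [LinearEquiv.mul_apply, rho_apply B α β h s, map_sub, rho_apply_self, map_smul, rho_apply, hz]
    module
  have hiff : B (α s) (β t) = 0 ↔ B (α t) (β s) = 0 := ⟨hzero hst, hzero (Ne.symm hst)⟩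
  refine ⟨fun _ => ⟨hle hst, hle (Ne.symm hst)⟩, hiff, ?_⟩
  obtain ⟨x, l, hx, hl, ha, hb⟩ := exists_scaling (hle hst) (hle (Ne.symm hst)) hiff
  have hab : B (α s) (β t) * B (α t) (β s) = x ^ 2 := by
    rw [ha]; linear_combination (-x) * hb
  rw [hab]
  rcases hx.eq_or_lt with rfl | hx
  · exact .inl ⟨2, le_rfl, by simp⟩
  rcases le_or_gt 1 x with hx1 | hx1
  · exact .inr (one_le_pow₀ hx1)
  left
  obtain ⟨m, hm, e⟩ := exists_eq_cos_of_eval_U hx hx1 (by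
    rintro k ⟨hk1, hk2⟩
    have hroot : ((alternatingWord s t (k + 1)).map (rho B α β h)).prod (α s) ∈
        roots B α β h := by
      refine ⟨_, Subgroup.list_prod_mem _ fun g hg => ?_, s, rfl⟩
      obtain ⟨i, -, rfl⟩ := List.mem_map.mp hg
      exact rho_mem_weylGroup h i
    rw [alternatingWord_apply B α β h ha hb] at hroot
    push_cast at hroot
    rw [add_sub_cancel_right] at hroot
    split_ifs at hroot
    · refine hno (Ne.symm hst) (mul_pos hl hk1) (neg_pos.mpr hk2) ?_
      rwa [neg_smul, sub_neg_eq_add, add_comm]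
    · refine hno hst hk1 (mul_pos hl (neg_pos.mpr hk2)) ?_
      rwa [mul_neg, neg_smul, sub_neg_eq_add])
  exact ⟨m, hm, by rw [e]⟩

theorem rootsDecompose_iff (hα : Function.Injective α)
    (h0 : (0 : V) ∉ PLC (Set.range α)) (hirr : ∀ s, α s ∉ PLC (Set.range α \ {α s})) :
    RootsDecompose B α β h ↔ ∀ s t, IsCoxeterPair B α β s t :=
  ⟨isCoxeterPair_of_rootsDecompose h hα h0 hirr, rootsDecompose_of_isCoxeterPair h h0⟩

theorem isCoxeterPair_flip (s t : S) :
    IsCoxeterPair B.flip β α s t ↔ IsCoxeterPair B α β t s := by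
  simp only [IsCoxeterPair, LinearMap.flip_apply, ne_comm, mul_comm]

end Decompose

end PairedRoots

theorem theorem2p2 {S V₁ V₂ : Type*} [AddCommGroup V₁] [Module ℝ V₁]
    [AddCommGroup V₂] [Module ℝ V₂] (B : V₁ →ₗ[ℝ] V₂ →ₗ[ℝ] ℝ)
    (α : S → V₁) (β : S → V₂)
    (hα : Function.Injective α) (hβ : Function.Injective β)
    (D1 : ∀ s, B (α s) (β s) = 1)
    (D2i : (0 : V₁) ∉ PairedRoots.PLC (Set.range α) ∧
      (0 : V₂) ∉ PairedRoots.PLC (Set.range β))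
    (D2ii : ∀ s, α s ∉ PairedRoots.PLC (Set.range α \ {α s}) ∧
      β s ∉ PairedRoots.PLC (Set.range β \ {β s})) :
    List.TFAE
      [PairedRoots.RootsDecompose B α β D1,
       PairedRoots.RootsDecompose B.flip β α D1,
       ∀ s t : S,
        (s ≠ t → B (α s) (β t) ≤ 0 ∧ B (α t) (β s) ≤ 0) ∧
        (B (α s) (β t) = 0 ↔ B (α t) (β s) = 0) ∧
        ((∃ m : ℕ, 2 ≤ m ∧ B (α s) (β t) * B (α t) (β s) = Real.cos (Real.pi / m) ^ 2) ∨
          1 ≤ B (α s) (β t) * B (α t) (β s))] := by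
  have h1 := PairedRoots.rootsDecompose_iff (B := B) (β := β) D1 hα D2i.1 fun s => (D2ii s).1
  have h2 := PairedRoots.rootsDecompose_iff (B := B.flip) (β := α) D1 hβ D2i.2 fun s => (D2ii s).2
  have h3 : (∀ s t, PairedRoots.IsCoxeterPair B.flip β α s t) ↔
      ∀ s t, PairedRoots.IsCoxeterPair B α β s t := by
    simp only [PairedRoots.isCoxeterPair_flip]
    exact forall_comm
  tfae_have 1 ↔ 3 := h1
  tfae_have 2 ↔ 3 := h2.trans h3
  tfae_finish
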